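/- For a measurable function $f:\mathbb{R}\to[0,\infty]$ let $f^{**}$ denote its symmetric non-increasing rearrangement, $f^{**}(x)=f^*(2|x|)$, where $f^*(t)=\inf\{s\in[0,\infty] : |\{f>s\}|\le t\}$ and $|\cdot|$ is Lebesgue measure. Call a function $K:\mathbb{R}^m\to[0,\infty]$ Steiner convex if for every $s\ge 0$ the set $C=\{z : K(z)>s\}$ is convex and balanced, i.e. $C=-C$. **Theorem 5.7 (Brascamp–Lieb–Luttinger).** Let $m,n\ge 0$ be integers, let $f_1,\dots,f_n:\mathbb{R}\to[0,\infty]$ be Lebesgue measurable functions, let $K:\mathbb{R}^m\to[0,\infty]$ be Steiner convex, and let $l_1,\dots,l_n:\mathbb{R}^m\to\mathbb{R}$ be non-zero linear functionals. Then $$\int_{\mathbb{R}^m}\prod_{j=1}^n f_j(l_j(z))\,K(z)\,dz\;\le\;\int_{\mathbb{R}^m}\prod_{j=1}^n f_j^{**}(l_j(z))\,K(z)\,dz ,$$ where both integrals are taken in $[0,\infty]$, with the convention $0\cdot\infty=0$. -/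

import Mathlib

open MeasureTheory
open scoped ENNReal

/-- The distribution function `s ↦ μ {f > s}` of a function `f` with values in `[0, ∞]`. -/
noncomputable def distributionFunction {α : Type*} [MeasurableSpace α] (μ : Measure α)
    (f : α → ℝ≥0∞) (s : ℝ≥0∞) : ℝ≥0∞ :=
  μ {x | s < f x}

/-- The non-increasing rearrangement `f^*(t) = inf {s : μ {f > s} ≤ t}`. -/
noncomputable def decreasingRearrangement {α : Type*} [MeasurableSpace α] (μ : Measure α)
    (f : α → ℝ≥0∞) (t : ℝ≥0∞) : ℝ≥0∞ :=
  sInf {s | distributionFunction μ f s ≤ t}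

/-- The symmetric (radial) non-increasing rearrangement `f^{**}(x) = f^*(2|x|)` of a function on
the real line; `2|x|` is the Lebesgue measure of the one-dimensional ball of radius `|x|`. -/
noncomputable def symmetricRearrangement (f : ℝ → ℝ≥0∞) (x : ℝ) : ℝ≥0∞ :=
  decreasingRearrangement volume f (ENNReal.ofReal (2 * |x|))

/-- A set `C` of `ℝ^m` which is convex and balanced in the sense that `C = -C`. -/
def IsBalancedConvex {m : ℕ} (C : Set (Fin m → ℝ)) : Prop :=
  Convex ℝ C ∧ ∀ z, z ∈ C ↔ -z ∈ C

/-- A function `K : ℝ^m → [0, ∞]` is Steiner convex if all its superlevel sets `{K > s}` are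
convex and balanced. -/
def IsSteinerConvex {m : ℕ} (K : (Fin m → ℝ) → ℝ≥0∞) : Prop :=
  ∀ s : ℝ≥0∞, IsBalancedConvex {z | s < K z}

open scoped Pointwise

/-! Slicing `K` and every `f j` into superlevel sets reduces the claim to sets: for `C` convex and
balanced, the volume of the points of `C` with `l j z ∈ A j` for all `j` does not decrease when each
`A j` becomes the centred open interval of the same measure (`measure_restrict_convex_le`).
Approximating `A j` by open supersets, and open sets from inside by finite unions of intervals,
leaves only such unions.

For single intervals with centres `c j`, slide the centres to `t * c j`. If `E` is the original
intersection, the new one contains `(1 + t)/2 • E + (1 - t)/2 • (-E)`, and `E`, `-E` have equal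
volume, so the multiplicative Brunn–Minkowski inequality, a case of Prékopa–Leindler, shows that
volume does not drop (`volume_inter_strips_le`).

For several intervals, expand the product, slide all centres at the same rate until two intervals of
one family touch, merge them and start again. The number of intervals falls until each family has at
most one, which is then slid to the origin (`setLIntegral_prod_intervalSum_le_Ico`). -/

/-! ### Layer cake formulas -/

theorem volume_restrict_Ioi_ofReal_lt (c : ℝ≥0∞) :
    (volume.restrict (Set.Ioi (0 : ℝ))) {s | ENNReal.ofReal s < c} = c := by
  rw [Measure.restrict_apply (measurableSet_lt ENNReal.measurable_ofReal measurable_const)]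
  by_cases hc : c = ∞
  · subst hc
    simp
  · have : {s | ENNReal.ofReal s < c} ∩ Set.Ioi (0 : ℝ) = Set.Ioo 0 c.toReal := by
      ext s
      simp only [Set.mem_inter_iff, Set.mem_ofPred_eq, Set.mem_Ioi, Set.mem_Ioo]
      constructor
      · rintro ⟨h1, h2⟩
        exact ⟨h2, (ENNReal.ofReal_lt_iff_lt_toReal h2.le hc).1 h1⟩
      · rintro ⟨h2, h1⟩
        exact ⟨(ENNReal.ofReal_lt_iff_lt_toReal h2.le hc).2 h1, h2⟩
    rw [this, Real.volume_Ioo, sub_zero, ENNReal.ofReal_toReal hc]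

/-- Layer cake formula for `ℝ≥0∞`-valued functions, with a weight. -/
theorem lintegral_mul_eq_lintegral_superlevel {α : Type*} [MeasurableSpace α] (ν : Measure α)
    [SFinite ν] {F G : α → ℝ≥0∞} (hF : Measurable F) (hG : Measurable G) :
    ∫⁻ x, F x * G x ∂ν =
      ∫⁻ s in Set.Ioi (0 : ℝ), ∫⁻ x, {x | ENNReal.ofReal s < F x}.indicator 1 x * G x ∂ν := by
  rw [lintegral_lintegral_swap]
  · refine lintegral_congr fun x => ?_
    have h : ∀ s : ℝ, {x | ENNReal.ofReal s < F x}.indicator (1 : α → ℝ≥0∞) x * G x =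
        {s | ENNReal.ofReal s < F x}.indicator (fun _ => G x) s := by
      intro s
      by_cases hs : ENNReal.ofReal s < F x <;> simp [Set.indicator, hs]
    simp_rw [h]
    rw [lintegral_indicator_const
      (measurableSet_lt ENNReal.measurable_ofReal measurable_const),
      volume_restrict_Ioi_ofReal_lt, mul_comm]
  · refine Measurable.aemeasurable ?_
    have h : Measurable fun p : ℝ × α =>
        {p : ℝ × α | ENNReal.ofReal p.1 < F p.2}.indicator 1 p * G p.2 :=
      (measurable_one.indicator (measurableSet_lt (ENNReal.measurable_ofReal.comp measurable_fst)
        (hF.comp measurable_snd))).mul (hG.comp measurable_snd)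
    exact h

theorem lintegral_eq_lintegral_volume_superlevel {α : Type*} [MeasurableSpace α] (ν : Measure α)
    [SFinite ν] {F : α → ℝ≥0∞} (hF : Measurable F) :
    ∫⁻ x, F x ∂ν = ∫⁻ s in Set.Ioi (0 : ℝ), ν {x | ENNReal.ofReal s < F x} := by
  have h := lintegral_mul_eq_lintegral_superlevel ν hF (measurable_const (a := (1 : ℝ≥0∞)))
  simp only [mul_one] at h
  rw [h]
  refine lintegral_congr fun s => ?_
  rw [lintegral_indicator_one (measurableSet_lt measurable_const hF)]

/-! ### Brunn–Minkowski and Prékopa–Leindler -/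

theorem volume_eq_iSup_nonempty_isCompact {A : Set ℝ} (hA : MeasurableSet A) :
    volume A = ⨆ K : {K : Set ℝ // K ⊆ A ∧ IsCompact K ∧ K.Nonempty}, volume (K : Set ℝ) := by
  refine le_antisymm (le_of_forall_lt fun r hr => ?_) (iSup_le fun K => measure_mono K.2.1)
  obtain ⟨K, hKA, hK, hr⟩ := hA.exists_lt_isCompact hr
  have hne : K.Nonempty := nonempty_of_measure_ne_zero (μ := volume) (ne_bot_of_gt hr)
  exact hr.trans_le (le_iSup
    (fun K : {K : Set ℝ // K ⊆ A ∧ IsCompact K ∧ K.Nonempty} => volume (K : Set ℝ))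
    ⟨K, hKA, hK, hne⟩)

theorem volume_image_affine {b : ℝ} (hb : 0 < b) (c : ℝ) (L : Set ℝ) :
    volume ((fun y => c + b * y) '' L) = ENNReal.ofReal b * volume L := by
  have : (fun y => c + b * y) '' L = (fun z => c + z) '' (b • L) := by
    rw [← Set.image_smul, Set.image_image]
    rfl
  rw [this, Set.image_add_left, measure_preimage_add, Measure.addHaar_smul]
  simp [abs_of_pos hb]

/-- The one-dimensional Brunn–Minkowski inequality. -/
theorem volume_convexCombination_le {a b : ℝ} (ha : 0 < a) (hb : 0 < b) {A B D : Set ℝ}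
    (hA : MeasurableSet A) (hB : MeasurableSet B) (hAn : A.Nonempty) (hBn : B.Nonempty)
    (hD : ∀ x ∈ A, ∀ y ∈ B, a * x + b * y ∈ D) :
    ENNReal.ofReal a * volume A + ENNReal.ofReal b * volume B ≤ volume D := by
  rw [volume_eq_iSup_nonempty_isCompact hA, volume_eq_iSup_nonempty_isCompact hB,
    ENNReal.mul_iSup, ENNReal.mul_iSup]
  have : Nonempty {K : Set ℝ // K ⊆ A ∧ IsCompact K ∧ K.Nonempty} := by
    obtain ⟨x, hx⟩ := hAn
    exact ⟨⟨{x}, by simpa using hx, isCompact_singleton, by simp⟩⟩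
  have : Nonempty {K : Set ℝ // K ⊆ B ∧ IsCompact K ∧ K.Nonempty} := by
    obtain ⟨x, hx⟩ := hBn
    exact ⟨⟨{x}, by simpa using hx, isCompact_singleton, by simp⟩⟩
  refine ENNReal.iSup_add_iSup_le ?_
  rintro ⟨K, hKA, hK, hKn⟩ ⟨L, hLB, hL, hLn⟩
  obtain ⟨p, hp, hpmax⟩ := hK.exists_isGreatest hKn
  obtain ⟨q, hq, hqmin⟩ := hL.exists_isLeast hLn
  -- With `p = max K` and `q = min L`, these translates of `a • K` and `b • L` lie on either side of
  -- `a * p + b * q`, meet at most there, and both lie in `D`.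
  set S := (fun x => b * q + a * x) '' K
  set T := (fun y => a * p + b * y) '' L
  have hT : MeasurableSet T :=
    (hL.image (by fun_prop)).measurableSet
  have hdisj : AEDisjoint volume S T := by
    refine measure_mono_null (t := {a * p + b * q}) ?_ (by simp)
    rintro _ ⟨⟨x, hx, rfl⟩, ⟨y, hy, hxy⟩⟩
    have h1 := hpmax hx
    have h2 := hqmin hy
    simp only [Set.mem_singleton_iff]
    simp only at hxy
    nlinarith
  calc ENNReal.ofReal a * volume K + ENNReal.ofReal b * volume L
      = volume S + volume T := by
        rw [volume_image_affine ha, volume_image_affine hb]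
    _ = volume (S ∪ T) := (measure_union₀ hT.nullMeasurableSet hdisj).symm
    _ ≤ volume D := by
        refine measure_mono (Set.union_subset ?_ ?_)
        · rintro _ ⟨x, hx, rfl⟩
          have := hD x (hKA hx) q (hLB hq)
          simpa [add_comm] using this
        · rintro _ ⟨y, hy, rfl⟩
          exact hD p (hKA hp) y (hLB hy)

theorem ENNReal.rpow_mul_rpow_le_ofReal_mul_add {a b : ℝ} (ha : 0 < a) (hb : 0 < b)
    (hab : a + b = 1) (X Y : ℝ≥0∞) :
    X ^ a * Y ^ b ≤ ENNReal.ofReal a * X + ENNReal.ofReal b * Y := by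
  have h := ENNReal.young_inequality (X ^ a) (Y ^ b) (Real.holderConjugate_one_div ha hb hab)
  rw [← ENNReal.rpow_mul, ← ENNReal.rpow_mul, mul_one_div_cancel ha.ne',
    mul_one_div_cancel hb.ne', ENNReal.rpow_one, ENNReal.rpow_one, one_div, one_div,
    ENNReal.ofReal_inv_of_pos ha, ENNReal.ofReal_inv_of_pos hb, div_eq_mul_inv, div_eq_mul_inv,
    inv_inv, inv_inv] at h
  simpa [mul_comm] using h

theorem ENNReal.rpow_mul_rpow_of_add_eq_one {a b : ℝ} (ha : 0 < a) (hb : 0 < b)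
    (hab : a + b = 1) (X : ℝ≥0∞) : X ^ a * X ^ b = X := by
  rw [← ENNReal.rpow_add_of_nonneg _ _ ha.le hb.le, hab, ENNReal.rpow_one]

/-- Apply one-dimensional Brunn–Minkowski to superlevel sets. Equal suprema make the sets of `f` and
`g` nonempty for exactly the same levels, as that inequality needs; this gives the stronger
arithmetic-mean bound. -/
theorem prekopa_leindler_real_of_iSup_eq_one {a b : ℝ} (ha : 0 < a) (hb : 0 < b) (hab : a + b = 1)
    {f g h : ℝ → ℝ≥0∞} (hf : Measurable f) (hg : Measurable g) (hh : Measurable h)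
    (H : ∀ x y, f x ^ a * g y ^ b ≤ h (a * x + b * y)) (hf1 : ⨆ x, f x = 1)
    (hg1 : ⨆ x, g x = 1) :
    ENNReal.ofReal a * (∫⁻ x, f x) + ENNReal.ofReal b * (∫⁻ x, g x) ≤ ∫⁻ x, h x := by
  have meas : ∀ {u : ℝ → ℝ≥0∞}, Measurable fun s : ℝ => volume {x | ENNReal.ofReal s < u x} := by
    intro u
    refine Antitone.measurable fun s t hst => measure_mono fun x hx => ?_
    exact lt_of_le_of_lt (ENNReal.ofReal_le_ofReal hst) hx
  rw [lintegral_eq_lintegral_volume_superlevel _ hf, lintegral_eq_lintegral_volume_superlevel _ hg,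
    lintegral_eq_lintegral_volume_superlevel _ hh, ← lintegral_const_mul _ meas,
    ← lintegral_const_mul _ meas, ← lintegral_add_left (meas.const_mul _)]
  refine lintegral_mono fun s => ?_
  by_cases hs : ENNReal.ofReal s < 1
  · have hne : ∀ {u : ℝ → ℝ≥0∞}, ⨆ x, u x = 1 → {x | ENNReal.ofReal s < u x}.Nonempty := by
      intro u hu
      obtain ⟨x, hx⟩ := lt_iSup_iff.1 (hu ▸ hs)
      exact ⟨x, hx⟩
    refine volume_convexCombination_le ha hb (measurableSet_lt measurable_const hf)
      (measurableSet_lt measurable_const hg) (hne hf1) (hne hg1)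
      fun x hx y hy => ?_
    refine lt_of_lt_of_le ?_ (H x y)
    rw [← ENNReal.rpow_mul_rpow_of_add_eq_one ha hb hab (ENNReal.ofReal s)]
    exact ENNReal.mul_lt_mul (ENNReal.rpow_lt_rpow hx ha) (ENNReal.rpow_lt_rpow hy hb)
  · have he : ∀ {u : ℝ → ℝ≥0∞}, ⨆ x, u x = 1 → {x | ENNReal.ofReal s < u x} = ∅ := by
      intro u hu
      refine Set.eq_empty_of_forall_notMem fun x hx => hs (lt_of_lt_of_le hx ?_)
      exact hu ▸ le_iSup u x
    simp [he hf1, he hg1]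

/-- Hypothesis and conclusion scale alike, so both suprema can be normalised to 1; weighted AM–GM
then turns the arithmetic mean into the geometric one. -/
theorem prekopa_leindler_real_of_iSup_ne_top {a b : ℝ} (ha : 0 < a) (hb : 0 < b) (hab : a + b = 1)
    {f g h : ℝ → ℝ≥0∞} (hf : Measurable f) (hg : Measurable g) (hh : Measurable h)
    (H : ∀ x y, f x ^ a * g y ^ b ≤ h (a * x + b * y)) (hf1 : ⨆ x, f x ≠ ∞)
    (hg1 : ⨆ x, g x ≠ ∞) :
    (∫⁻ x, f x) ^ a * (∫⁻ x, g x) ^ b ≤ ∫⁻ x, h x := by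
  set M := ⨆ x, f x with hM
  set N := ⨆ x, g x with hN
  by_cases hM0 : M = 0
  · have : ∀ x, f x = 0 := fun x => le_antisymm (hM0 ▸ le_iSup f x) zero_le
    simp [this, ENNReal.zero_rpow_of_pos ha]
  by_cases hN0 : N = 0
  · have : ∀ x, g x = 0 := fun x => le_antisymm (hN0 ▸ le_iSup g x) zero_le
    simp [this, ENNReal.zero_rpow_of_pos hb]
  have hMa0 : M ^ a ≠ 0 := by simp [ENNReal.rpow_eq_zero_iff, hM0, hf1]
  have hNb0 : N ^ b ≠ 0 := by simp [ENNReal.rpow_eq_zero_iff, hN0, hg1]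
  have hMa : M ^ a ≠ ∞ := ENNReal.rpow_ne_top_of_nonneg ha.le hf1
  have hNb : N ^ b ≠ ∞ := ENNReal.rpow_ne_top_of_nonneg hb.le hg1
  set P := M ^ a * N ^ b
  have hP0 : P ≠ 0 := mul_ne_zero hMa0 hNb0
  have hP : P ≠ ∞ := ENNReal.mul_ne_top hMa hNb
  have hscale : ∀ X Y : ℝ≥0∞, (M⁻¹ * X) ^ a * (N⁻¹ * Y) ^ b = P⁻¹ * (X ^ a * Y ^ b) := by
    intro X Y
    rw [ENNReal.mul_rpow_of_nonneg _ _ ha.le, ENNReal.mul_rpow_of_nonneg _ _ hb.le,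
      ENNReal.inv_rpow, ENNReal.inv_rpow, ENNReal.mul_inv (Or.inl hMa0) (Or.inl hMa)]
    ring
  have key := prekopa_leindler_real_of_iSup_eq_one ha hb hab (f := fun x => M⁻¹ * f x)
    (g := fun x => N⁻¹ * g x) (h := fun x => P⁻¹ * h x) (hf.const_mul _) (hg.const_mul _)
    (hh.const_mul _) (fun x y => by rw [hscale]; gcongr; exact H x y)
    (by rw [← ENNReal.mul_iSup, ENNReal.inv_mul_cancel hM0 hf1])
    (by rw [← ENNReal.mul_iSup, ENNReal.inv_mul_cancel hN0 hg1])
  have key2 := (ENNReal.rpow_mul_rpow_le_ofReal_mul_add ha hb hab _ _).trans key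
  rw [lintegral_const_mul _ hf, lintegral_const_mul _ hg, lintegral_const_mul _ hh, hscale] at key2
  exact (ENNReal.mul_le_mul_iff_right (ENNReal.inv_ne_zero.2 hP) (ENNReal.inv_ne_top.2 hP0)).1 key2

theorem tendsto_lintegral_min_natCast {α : Type*} [MeasurableSpace α] (μ : Measure α)
    {f : α → ℝ≥0∞} (hf : Measurable f) :
    Filter.Tendsto (fun k : ℕ => ∫⁻ x, min (f x) k ∂μ) Filter.atTop (nhds (∫⁻ x, f x ∂μ)) := by
  refine lintegral_tendsto_of_tendsto_of_monotone
    (fun k => (hf.min measurable_const).aemeasurable) ?_ ?_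
  · exact Filter.Eventually.of_forall fun x i j hij => by
      exact min_le_min_left _ (Nat.cast_le.2 hij)
  · refine Filter.Eventually.of_forall fun x => ?_
    have := (tendsto_const_nhds (x := f x)).min ENNReal.tendsto_nat_nhds_top
    simpa using this

/-- The Prékopa–Leindler inequality on the real line. -/
theorem prekopa_leindler_real {a b : ℝ} (ha : 0 < a) (hb : 0 < b) (hab : a + b = 1)
    {f g h : ℝ → ℝ≥0∞} (hf : Measurable f) (hg : Measurable g) (hh : Measurable h)
    (H : ∀ x y, f x ^ a * g y ^ b ≤ h (a * x + b * y)) :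
    (∫⁻ x, f x) ^ a * (∫⁻ x, g x) ^ b ≤ ∫⁻ x, h x := by
  by_cases hf0 : ∫⁻ x, f x = 0
  · simp [hf0, ENNReal.zero_rpow_of_pos ha]
  by_cases hg0 : ∫⁻ x, g x = 0
  · simp [hg0, ENNReal.zero_rpow_of_pos hb]
  -- Zero integrals were treated first because multiplication on `ℝ≥0∞` is not continuous at `(0,
  -- ∞)`.
  have hlim := ENNReal.Tendsto.mul
    ((tendsto_lintegral_min_natCast volume hf).ennrpow_const a)
    (Or.inl (by simp [ENNReal.rpow_eq_zero_iff, hf0, ha.not_gt]))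
    ((tendsto_lintegral_min_natCast volume hg).ennrpow_const b)
    (Or.inl (by simp [ENNReal.rpow_eq_zero_iff, hg0, hb.not_gt]))
  refine le_of_tendsto' hlim fun k => ?_
  refine prekopa_leindler_real_of_iSup_ne_top ha hb hab (hf.min measurable_const)
    (hg.min measurable_const) hh (fun x y => le_trans ?_ (H x y)) ?_ ?_
  · gcongr <;> exact min_le_left _ _
  · exact ne_top_of_le_ne_top (ENNReal.natCast_ne_top k) (iSup_le fun x => min_le_right _ _)
  · exact ne_top_of_le_ne_top (ENNReal.natCast_ne_top k) (iSup_le fun x => min_le_right _ _)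

theorem measurable_fin_cons (m : ℕ) :
    Measurable fun p : ℝ × (Fin m → ℝ) => (Fin.cons p.1 p.2 : Fin (m + 1) → ℝ) := by
  refine measurable_pi_lambda _ fun i => ?_
  refine Fin.cases ?_ (fun j => ?_) i
  · simpa using measurable_fst
  · simpa [Function.comp_def] using (measurable_pi_apply j).comp (measurable_snd (α := ℝ))

theorem lintegral_fin_succ {m : ℕ} {f : (Fin (m + 1) → ℝ) → ℝ≥0∞} (hf : Measurable f) :
    ∫⁻ z, f z = ∫⁻ x : ℝ, ∫⁻ y : Fin m → ℝ, f (Fin.cons x y) := by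
  have h := (volume_preserving_piFinSuccAbove (fun _ : Fin (m + 1) => ℝ) 0).symm
  rw [← h.lintegral_comp hf, Measure.volume_eq_prod, lintegral_prod]
  · simp [MeasurableEquiv.piFinSuccAbove, Fin.insertNthEquiv]
  · exact (hf.comp (MeasurableEquiv.measurable _)).aemeasurable

/-- The Prékopa–Leindler inequality. -/
theorem prekopa_leindler {a b : ℝ} (ha : 0 < a) (hb : 0 < b) (hab : a + b = 1) (m : ℕ)
    {f g h : (Fin m → ℝ) → ℝ≥0∞} (hf : Measurable f) (hg : Measurable g) (hh : Measurable h)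
    (H : ∀ x y, f x ^ a * g y ^ b ≤ h (a • x + b • y)) :
    (∫⁻ x, f x) ^ a * (∫⁻ x, g x) ^ b ≤ ∫⁻ x, h x := by
  induction m with
  | zero =>
    have hv : (volume : Measure (Fin 0 → ℝ)) Set.univ = 1 := by
      rw [volume_pi, Measure.pi_univ]
      simp
    simp only [lintegral_unique, hv, mul_one]
    convert H default default
  | succ m ih =>
    have hmeas : ∀ {u : (Fin (m + 1) → ℝ) → ℝ≥0∞}, Measurable u →
        Measurable fun p : ℝ × (Fin m → ℝ) => u (Fin.cons p.1 p.2) :=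
      fun hu => hu.comp (measurable_fin_cons m)
    rw [lintegral_fin_succ hf, lintegral_fin_succ hg, lintegral_fin_succ hh]
    refine prekopa_leindler_real ha hb hab (hmeas hf).lintegral_prod_right'
      (hmeas hg).lintegral_prod_right' (hmeas hh).lintegral_prod_right' fun x y => ?_
    -- On slices, the induction hypothesis is exactly the one-dimensional hypothesis for the
    -- marginals.
    refine ih ((hmeas hf).comp measurable_prodMk_left) ((hmeas hg).comp measurable_prodMk_left)
      ((hmeas hh).comp measurable_prodMk_left) fun u v => ?_
    convert H (Fin.cons x u) (Fin.cons y v) using 2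
    ext i
    refine Fin.cases ?_ (fun j => ?_) i <;> simp

/-- A multiplicative form of the Brunn–Minkowski inequality, for measurable sets. -/
theorem volume_rpow_mul_volume_rpow_le {a b : ℝ} (ha : 0 < a) (hb : 0 < b) (hab : a + b = 1)
    {m : ℕ} {A B D : Set (Fin m → ℝ)} (hA : MeasurableSet A) (hB : MeasurableSet B)
    (hD : MeasurableSet D) (H : ∀ x ∈ A, ∀ y ∈ B, a • x + b • y ∈ D) :
    volume A ^ a * volume B ^ b ≤ volume D := by
  have := prekopa_leindler ha hb hab m (f := A.indicator 1) (g := B.indicator 1)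
    (h := D.indicator 1) (measurable_one.indicator hA) (measurable_one.indicator hB)
    (measurable_one.indicator hD) ?_
  · simpa [lintegral_indicator_one, hA, hB, hD] using this
  · intro x y
    by_cases hx : x ∈ A <;> by_cases hy : y ∈ B <;>
      simp [hx, hy, ENNReal.zero_rpow_of_pos ha, ENNReal.zero_rpow_of_pos hb, H]

/-! ### Sliding strips towards the origin -/

/-- A nonzero functional is onto and pushes Lebesgue measure to a multiple of Lebesgue measure. All
uses of `l j ≠ 0` go through this. -/
theorem quasiMeasurePreserving_of_ne_zero {m : ℕ} {l : (Fin m → ℝ) →ₗ[ℝ] ℝ} (hl : l ≠ 0) :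
    Measure.QuasiMeasurePreserving l volume volume := by
  refine ⟨l.continuous_of_finiteDimensional.measurable, ?_⟩
  obtain ⟨c, -, hc⟩ := LinearMap.exists_map_addHaar_eq_smul_addHaar l volume volume
    (LinearMap.surjective hl)
  rw [hc]
  exact Measure.smul_absolutelyContinuous

theorem ae_apply_ne {m : ℕ} {l : (Fin m → ℝ) →ₗ[ℝ] ℝ} (hl : l ≠ 0) (a : ℝ) :
    ∀ᵐ z : Fin m → ℝ, l z ≠ a :=
  (quasiMeasurePreserving_of_ne_zero hl).ae (Measure.ae_ne volume a)

theorem isOpen_setOf_abs_apply_sub_lt {m n : ℕ} (l : Fin n → (Fin m → ℝ) →ₗ[ℝ] ℝ)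
    (c r : Fin n → ℝ) : IsOpen {z | ∀ j, |l j z - c j| < r j} := by
  have : {z | ∀ j, |l j z - c j| < r j} = ⋂ j, {z | |l j z - c j| < r j} := by
    ext z
    simp
  rw [this]
  refine isOpen_iInter_of_finite fun j => ?_
  have := (l j).continuous_of_finiteDimensional
  exact isOpen_lt (by fun_prop) continuous_const

/-- Moving all the strips `|l j z - c j| < r j` towards the origin at the same rate does not
decrease the volume of their intersection with a symmetric convex set. -/
theorem volume_inter_strips_le {m n : ℕ} {C : Set (Fin m → ℝ)} (hC : Convex ℝ C) (hCo : IsOpen C)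
    (hCs : ∀ z ∈ C, -z ∈ C) (l : Fin n → (Fin m → ℝ) →ₗ[ℝ] ℝ) (c r : Fin n → ℝ) {t : ℝ}
    (ht0 : 0 ≤ t) (ht1 : t ≤ 1) :
    volume (C ∩ {z | ∀ j, |l j z - c j| < r j}) ≤
      volume (C ∩ {z | ∀ j, |l j z - t * c j| < r j}) := by
  rcases ht1.eq_or_lt with rfl | ht1
  · simp
  set E := C ∩ {z | ∀ j, |l j z - c j| < r j}
  have hE : MeasurableSet E := (hCo.inter (isOpen_setOf_abs_apply_sub_lt l c r)).measurableSet
  have hE' : MeasurableSet (C ∩ {z | ∀ j, |l j z - t * c j| < r j}) :=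
    (hCo.inter (isOpen_setOf_abs_apply_sub_lt l (fun j => t * c j) r)).measurableSet
  -- The weights sum to 1 and differ by `t`, so combining centres `c j` (from `E`) and `-c j` (from
  -- `-E`) gives `t * c j`.
  have ha : 0 < (1 + t) / 2 := by linarith
  have hb : 0 < (1 - t) / 2 := by linarith
  have hab : (1 + t) / 2 + (1 - t) / 2 = 1 := by ring
  rw [← ENNReal.rpow_mul_rpow_of_add_eq_one ha hb hab (volume E)]
  nth_rewrite 2 [← Measure.measure_neg volume E]
  refine volume_rpow_mul_volume_rpow_le ha hb hab hE hE.neg hE' ?_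
  rintro x ⟨hxC, hx⟩ y ⟨hyC, hy⟩
  refine ⟨hC hxC (by simpa using hCs _ hyC) ha.le hb.le hab, fun j => ?_⟩
  have h1 := abs_lt.1 (hx j)
  have h2 := abs_lt.1 (hy j)
  simp only [map_neg] at h2
  simp only [map_add, map_smul, smul_eq_mul]
  rw [abs_lt]
  constructor <;> nlinarith

theorem setLIntegral_prod_indicator_Ico {m n : ℕ} (C : Set (Fin m → ℝ))
    {l : Fin n → (Fin m → ℝ) →ₗ[ℝ] ℝ} (hl : ∀ j, l j ≠ 0) (c r : Fin n → ℝ) :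
    ∫⁻ z in C, ∏ j, (Set.Ico (c j - r j) (c j + r j)).indicator (1 : ℝ → ℝ≥0∞) (l j z) =
      volume (C ∩ {z | ∀ j, |l j z - c j| < r j}) := by
  have hm := (isOpen_setOf_abs_apply_sub_lt l c r).measurableSet
  rw [Set.inter_comm, ← Measure.restrict_apply hm, ← lintegral_indicator_one hm]
  refine lintegral_congr_ae (ae_restrict_of_ae ?_)
  -- Half-open and open intervals differ in the left endpoint, whose preimage is null.
  filter_upwards [ae_all_iff.2 fun j => ae_apply_ne (hl j) (c j - r j)] with z hz
  by_cases h : ∀ j, |l j z - c j| < r j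
  · rw [Set.indicator_of_mem (by exact h)]
    refine Finset.prod_eq_one fun j _ => Set.indicator_of_mem ?_ _
    have := abs_lt.1 (h j)
    constructor <;> linarith
  · rw [Set.indicator_of_notMem (by exact h)]
    push Not at h
    obtain ⟨j, hj⟩ := h
    refine Finset.prod_eq_zero (Finset.mem_univ j) (Set.indicator_of_notMem ?_ _)
    rintro ⟨h1, h2⟩
    have h1' := lt_of_le_of_ne h1 (hz j).symm
    exact hj.not_gt (abs_lt.2 ⟨by linarith, by linarith⟩)

/-! ### Finite unions of intervals: sliding and merging -/

/-- The multiplicity function of the family of half-open intervals of centres `t * p.1` and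
half-lengths `p.2`, where `p` ranges over `S`. -/
noncomputable def intervalSum (S : Finset (ℝ × ℝ)) (t x : ℝ) : ℝ≥0∞ :=
  ∑ p ∈ S, (Set.Ico (t * p.1 - p.2) (t * p.1 + p.2)).indicator 1 x

/-- The intervals described by `S` have positive lengths and do not overlap. -/
def IsSeparated (S : Finset (ℝ × ℝ)) : Prop :=
  (∀ p ∈ S, 0 < p.2) ∧ ∀ p ∈ S, ∀ q ∈ S, p ≠ q → p.2 + q.2 ≤ |p.1 - q.1|

theorem measurable_intervalSum (S : Finset (ℝ × ℝ)) (t : ℝ) : Measurable (intervalSum S t) :=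
  Finset.measurable_fun_sum _ fun _ _ => measurable_one.indicator measurableSet_Ico

/-- Expanding the product gives one strip intersection for each choice of one interval per `j`; each
term is monotone separately, so overlaps are harmless. -/
theorem setLIntegral_prod_intervalSum_le {m n : ℕ} {C : Set (Fin m → ℝ)} (hC : Convex ℝ C)
    (hCo : IsOpen C) (hCs : ∀ z ∈ C, -z ∈ C) {l : Fin n → (Fin m → ℝ) →ₗ[ℝ] ℝ}
    (hl : ∀ j, l j ≠ 0) (S : Fin n → Finset (ℝ × ℝ)) {t : ℝ} (ht0 : 0 ≤ t) (ht1 : t ≤ 1) :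
    ∫⁻ z in C, ∏ j, intervalSum (S j) 1 (l j z) ≤ ∫⁻ z in C, ∏ j, intervalSum (S j) t (l j z) := by
  have hexp : ∀ s : ℝ, ∫⁻ z in C, ∏ j, intervalSum (S j) s (l j z) =
      ∑ p ∈ Fintype.piFinset S,
        volume (C ∩ {z | ∀ j, |l j z - s * (p j).1| < (p j).2}) := by
    intro s
    have : ∀ z, ∏ j, intervalSum (S j) s (l j z) = ∑ p ∈ Fintype.piFinset S,
        ∏ j, (Set.Ico (s * (p j).1 - (p j).2) (s * (p j).1 + (p j).2)).indicator
          (1 : ℝ → ℝ≥0∞) (l j z) := fun z => Finset.prod_univ_sum _ _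
    simp_rw [this]
    rw [lintegral_finsetSum']
    · exact Finset.sum_congr rfl fun p _ =>
        setLIntegral_prod_indicator_Ico C hl (fun j => s * (p j).1)
          (fun j => (p j).2)
    · exact fun p _ => (Finset.measurable_fun_prod _ fun j _ =>
        (measurable_one.indicator measurableSet_Ico).comp
          (l j).continuous_of_finiteDimensional.measurable).aemeasurable
  rw [hexp, hexp]
  refine Finset.sum_le_sum fun p _ => ?_
  simp only [one_mul]
  exact volume_inter_strips_le hC hCo hCs l (fun j => (p j).1) (fun j => (p j).2) ht0 ht1

/-- Makes the configuration at time `t` a new initial configuration; `t > 0` keeps distinct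
intervals distinct. -/
theorem IsSeparated.exists_scale {S : Finset (ℝ × ℝ)} (hS : IsSeparated S) {t : ℝ} (ht : 0 < t)
    (h : ∀ p ∈ S, ∀ q ∈ S, p ≠ q → p.2 + q.2 ≤ t * |p.1 - q.1|) :
    ∃ S' : Finset (ℝ × ℝ), IsSeparated S' ∧ (∀ p ∈ S, (t * p.1, p.2) ∈ S') ∧
      (∀ x, intervalSum S' 1 x = intervalSum S t x) ∧
      ∑ p ∈ S', p.2 = ∑ p ∈ S, p.2 ∧ S'.card ≤ S.card := by
  have hinj : Function.Injective fun p : ℝ × ℝ => (t * p.1, p.2) := by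
    rintro ⟨a, b⟩ ⟨c, d⟩ hpq
    simpa [ht.ne'] using hpq
  refine ⟨S.image fun p => (t * p.1, p.2), ⟨?_, ?_⟩, fun p hp => Finset.mem_image_of_mem _ hp,
    fun x => ?_, ?_, Finset.card_image_le⟩
  · intro p hp
    obtain ⟨q, hq, rfl⟩ := Finset.mem_image.1 hp
    exact hS.1 q hq
  · intro p hp p' hp' hne
    obtain ⟨q, hq, rfl⟩ := Finset.mem_image.1 hp
    obtain ⟨q', hq', rfl⟩ := Finset.mem_image.1 hp'
    have := h q hq q' hq' (fun h => hne (by rw [h]))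
    simpa [← mul_sub, abs_mul, abs_of_pos ht] using this
  · rw [intervalSum, Finset.sum_image hinj.injOn]
    simp [intervalSum]
  · rw [Finset.sum_image hinj.injOn]

theorem indicator_Ico_add_indicator_Ico {a b c : ℝ} (hab : a ≤ b) (hbc : b ≤ c) (x : ℝ) :
    (Set.Ico a b).indicator (1 : ℝ → ℝ≥0∞) x + (Set.Ico b c).indicator 1 x =
      (Set.Ico a c).indicator 1 x := by
  rw [← Set.Ico_union_Ico_eq_Ico hab hbc, Set.indicator_union_of_disjoint
    (Set.Ico_disjoint_Ico_same)]

/-- Two adjacent intervals can be merged. -/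
theorem IsSeparated.exists_merge {S : Finset (ℝ × ℝ)} (hS : IsSeparated S) {p q : ℝ × ℝ}
    (hp : p ∈ S) (hq : q ∈ S) (hpq : q.1 - p.1 = p.2 + q.2) :
    ∃ S' : Finset (ℝ × ℝ), IsSeparated S' ∧
      (∀ x, intervalSum S' 1 x = intervalSum S 1 x) ∧
      ∑ p ∈ S', p.2 = ∑ p ∈ S, p.2 ∧ S'.card < S.card := by
  have hp0 := hS.1 p hp
  have hq0 := hS.1 q hq
  have hne : q ≠ p := by
    rintro rfl
    linarith
  set R := (S.erase p).erase q
  have hqe : q ∈ S.erase p := Finset.mem_erase.2 ⟨hne, hq⟩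
  have hsum : ∀ {M : Type} [AddCommMonoid M] (F : ℝ × ℝ → M),
      ∑ a ∈ S, F a = F p + (F q + ∑ a ∈ R, F a) := by
    intro M _ F
    rw [← Finset.add_sum_erase S F hp, ← Finset.add_sum_erase (S.erase p) F hqe]
  have hcard : R.card + 2 = S.card := by
    rw [← Finset.card_erase_add_one hp, ← Finset.card_erase_add_one hqe]
  set w : ℝ × ℝ := (p.1 + q.2, p.2 + q.2) with hw
  have hwR : ∀ a ∈ R, a.2 + w.2 ≤ |a.1 - w.1| := by
    intro a ha
    have haq := (Finset.mem_erase.1 ha).1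
    have hap := (Finset.mem_erase.1 (Finset.mem_erase.1 ha).2).1
    have haS := (Finset.mem_erase.1 (Finset.mem_erase.1 ha).2).2
    have ha0 := hS.1 a haS
    have h1 := hS.2 a haS p hp hap
    have h2 := hS.2 a haS q hq haq
    rw [hw, le_abs]
    -- In the mixed cases `a` would lie between the touching `p` and `q`, or both left of `p` and
    -- right of `q`; positive lengths exclude both.
    rcases le_abs.1 h1 with h1 | h1 <;> rcases le_abs.1 h2 with h2 | h2
    · left; simp only; linarith
    · linarith
    · linarith
    · right; simp only; linarith
  have hwnot : w ∉ R := by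
    intro hmem
    have := hwR w hmem
    simp only [sub_self, abs_zero, hw] at this
    linarith
  refine ⟨insert w R, ⟨?_, ?_⟩, fun x => ?_, ?_, ?_⟩
  · intro a ha
    rcases Finset.mem_insert.1 ha with rfl | ha
    · exact add_pos hp0 hq0
    · exact hS.1 a (Finset.mem_of_mem_erase (Finset.mem_of_mem_erase ha))
  · intro a ha b hb hab
    rcases Finset.mem_insert.1 ha with rfl | ha <;> rcases Finset.mem_insert.1 hb with rfl | hb
    · exact absurd rfl hab
    · rw [add_comm, abs_sub_comm]
      exact hwR b hb
    · exact hwR a ha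
    · exact hS.2 a (Finset.mem_of_mem_erase (Finset.mem_of_mem_erase ha)) b
        (Finset.mem_of_mem_erase (Finset.mem_of_mem_erase hb)) hab
  · rw [intervalSum, intervalSum, Finset.sum_insert hwnot, hsum]
    refine Eq.trans (congrArg₂ (· + ·) ?_ rfl) (add_assoc _ _ _)
    have := indicator_Ico_add_indicator_Ico (a := p.1 - p.2) (b := p.1 + p.2) (c := q.1 + q.2)
      (by linarith) (by linarith) x
    simp only [one_mul]
    rw [show w.1 - w.2 = p.1 - p.2 by simp only [hw]; ring,
      show w.1 + w.2 = q.1 + q.2 by simp only [hw]; linarith,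
      show q.1 - q.2 = p.1 + p.2 by linarith, this]
  · rw [Finset.sum_insert hwnot, hsum, ← add_assoc]
  · have := Finset.card_insert_le w R
    omega

theorem intervalSum_zero_of_card_le_one {S : Finset (ℝ × ℝ)} (hS : S.card ≤ 1) (x : ℝ) :
    intervalSum S 0 x =
      (Set.Ico (-∑ p ∈ S, p.2) (∑ p ∈ S, p.2)).indicator 1 x := by
  obtain ⟨p, hp⟩ := Finset.card_le_one_iff_subset_singleton.1 hS
  rcases Finset.subset_singleton_iff.1 hp with rfl | rfl <;> simp [intervalSum]

/-- The inequality for finite unions of intervals: the intervals are moved towards the origin and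
merged when they become adjacent. -/
theorem setLIntegral_prod_intervalSum_le_Ico {m n : ℕ} {C : Set (Fin m → ℝ)} (hC : Convex ℝ C)
    (hCo : IsOpen C) (hCs : ∀ z ∈ C, -z ∈ C) {l : Fin n → (Fin m → ℝ) →ₗ[ℝ] ℝ}
    (hl : ∀ j, l j ≠ 0) (S : Fin n → Finset (ℝ × ℝ)) (hS : ∀ j, IsSeparated (S j)) :
    ∫⁻ z in C, ∏ j, intervalSum (S j) 1 (l j z) ≤
      ∫⁻ z in C, ∏ j, (Set.Ico (-∑ p ∈ S j, p.2) (∑ p ∈ S j, p.2)).indicator 1 (l j z) := by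
  induction hN : ∑ j, (S j).card using Nat.strong_induction_on generalizing S with
  | _ N ih =>
  by_cases hcard : ∀ j, (S j).card ≤ 1
  · refine (setLIntegral_prod_intervalSum_le hC hCo hCs hl S le_rfl zero_le_one).trans_eq ?_
    simp_rw [fun j => intervalSum_zero_of_card_le_one (hcard j)]
  push Not at hcard
  obtain ⟨i, hi⟩ := hcard
  set P : Finset (Fin n × ((ℝ × ℝ) × (ℝ × ℝ))) :=
    (Finset.univ.biUnion fun j => (S j).offDiag.image fun a => (j, a)) with hP
  have hPmem : ∀ j p q, (j, (p, q)) ∈ P ↔ p ∈ S j ∧ q ∈ S j ∧ p ≠ q := by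
    intro j p q
    simp [hP]
  have hPne : P.Nonempty := by
    obtain ⟨p, hp, q, hq, hpq⟩ := Finset.one_lt_card.1 hi
    exact ⟨(i, (p, q)), (hPmem _ _ _).2 ⟨hp, hq, hpq⟩⟩
  -- Two intervals touch when `t` is the sum of their half-lengths over the distance of their
  -- centres. As `t` decreases from 1, the first collision is at the largest ratio.
  obtain ⟨⟨k, p, q⟩, hmem, hmax⟩ := P.exists_max_image
    (fun a => (a.2.1.2 + a.2.2.2) / |a.2.1.1 - a.2.2.1|) hPne
  obtain ⟨hp, hq, hpq⟩ := (hPmem _ _ _).1 hmem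
  have hpos : ∀ j, ∀ p ∈ S j, ∀ q ∈ S j, p ≠ q → 0 < |p.1 - q.1| := fun j p hp q hq hpq =>
    (add_pos ((hS j).1 p hp) ((hS j).1 q hq)).trans_le ((hS j).2 p hp q hq hpq)
  set t := (p.2 + q.2) / |p.1 - q.1| with ht
  have ht0 : 0 < t := div_pos (add_pos ((hS k).1 p hp) ((hS k).1 q hq)) (hpos k p hp q hq hpq)
  have ht1 : t ≤ 1 := (div_le_one (hpos k p hp q hq hpq)).2 ((hS k).2 p hp q hq hpq)
  have hsep : ∀ j, ∀ p ∈ S j, ∀ q ∈ S j, p ≠ q → p.2 + q.2 ≤ t * |p.1 - q.1| := by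
    intro j p' hp' q' hq' hne
    exact (div_le_iff₀ (hpos j p' hp' q' hq' hne)).1
      (hmax (j, (p', q')) ((hPmem _ _ _).2 ⟨hp', hq', hne⟩))
  have htpq : t * |p.1 - q.1| = p.2 + q.2 := div_mul_cancel₀ _ (hpos k p hp q hq hpq).ne'
  have hex : ∀ j, ∃ S' : Finset (ℝ × ℝ), IsSeparated S' ∧
      (∀ x, intervalSum S' 1 x = intervalSum (S j) t x) ∧
      ∑ p ∈ S', p.2 = ∑ p ∈ S j, p.2 ∧ S'.card ≤ (S j).card ∧ (j = k → S'.card < (S j).card) := by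
    intro j
    obtain ⟨S', h1, h2, h3, h4, h5⟩ := (hS j).exists_scale ht0 (hsep j)
    by_cases hj : j = k
    · subst hj
      have hmerge : ∃ S'' : Finset (ℝ × ℝ), IsSeparated S'' ∧
          (∀ x, intervalSum S'' 1 x = intervalSum S' 1 x) ∧
          ∑ p ∈ S'', p.2 = ∑ p ∈ S', p.2 ∧ S''.card < S'.card := by
        rcases abs_cases (p.1 - q.1) with ⟨h, -⟩ | ⟨h, -⟩
        · refine h1.exists_merge (h2 q hq) (h2 p hp) ?_
          simp only
          rw [h] at htpq
          linarith
        · refine h1.exists_merge (h2 p hp) (h2 q hq) ?_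
          simp only
          rw [h] at htpq
          linarith
      obtain ⟨S'', g1, g2, g3, g4⟩ := hmerge
      exact ⟨S'', g1, fun x => (g2 x).trans (h3 x), g3.trans h4, by omega, fun _ => by omega⟩
    · exact ⟨S', h1, h3, h4, h5, fun h => absurd h hj⟩
  choose S' h1 h2 h3 h4 h5 using hex
  have hlt : ∑ j, (S' j).card < N := hN ▸
    Finset.sum_lt_sum (fun j _ => h4 j) ⟨k, Finset.mem_univ k, h5 k rfl⟩
  refine (setLIntegral_prod_intervalSum_le hC hCo hCs hl S ht0.le ht1).trans ?_
  have := ih _ hlt S' h1 rfl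
  simp_rw [h2, h3] at this
  exact this

/-! ### From intervals to open and measurable sets -/

theorem indicator_Ico_grid {k : ℝ} (hk : 0 < k) (i : ℤ) (x : ℝ) :
    (Set.Ico (1 * ((i + 1 / 2) / k) - 1 / (2 * k)) (1 * ((i + 1 / 2) / k) + 1 / (2 * k))).indicator
      (1 : ℝ → ℝ≥0∞) x = if ⌊x * k⌋ = i then 1 else 0 := by
  have h1 : 1 * ((i + 1 / 2) / k) - 1 / (2 * k) = i / k := by
    field_simp
    ring
  have h2 : 1 * ((i + 1 / 2) / k) + 1 / (2 * k) = (i + 1) / k := by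
    field_simp
    ring
  rw [h1, h2, Set.indicator_apply]
  simp only [Set.mem_Ico, div_le_iff₀ hk, lt_div_iff₀ hk, Int.floor_eq_iff, Pi.one_apply]

theorem isSeparated_grid {k : ℝ} (hk : 0 < k) (F : Finset ℤ) :
    IsSeparated (F.image fun i : ℤ => (((i : ℝ) + 1 / 2) / k, 1 / (2 * k))) := by
  constructor
  · intro p hp
    obtain ⟨i, -, rfl⟩ := Finset.mem_image.1 hp
    positivity
  · intro p hp q hq hpq
    obtain ⟨i, -, rfl⟩ := Finset.mem_image.1 hp
    obtain ⟨j, -, rfl⟩ := Finset.mem_image.1 hq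
    have hij : i ≠ j := fun h => hpq (by rw [h])
    have h1 : (1 : ℝ) ≤ |(i : ℝ) - j| := by
      exact_mod_cast Int.one_le_abs (sub_ne_zero.2 hij)
    have h2 : ((i : ℝ) + 1 / 2) / k - ((j : ℝ) + 1 / 2) / k = (i - j) / k := by ring
    have h3 : 1 / (2 * k) + 1 / (2 * k) = 1 / k := by
      field_simp
      ring
    simp only
    rw [h2, h3, abs_div, abs_of_pos hk]
    gcongr

theorem intervalSum_grid {k : ℝ} (hk : 0 < k) (F : Finset ℤ) (x : ℝ) :
    intervalSum (F.image fun i : ℤ => (((i : ℝ) + 1 / 2) / k, 1 / (2 * k))) 1 x =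
      if ⌊x * k⌋ ∈ F then 1 else 0 := by
  have hinj : Function.Injective fun i : ℤ => (((i : ℝ) + 1 / 2) / k, 1 / (2 * k)) := by
    intro i j hij
    simp only [Prod.mk.injEq, and_true] at hij
    rw [div_left_inj' hk.ne'] at hij
    exact_mod_cast add_right_cancel hij
  rw [intervalSum, Finset.sum_image hinj.injOn]
  simp_rw [fun i => indicator_Ico_grid hk i x]
  rw [Finset.sum_ite_eq]

/-- An open set of real numbers is the limit of finite unions of intervals that it contains. -/
theorem exists_isSeparated_tendsto {U : Set ℝ} (hU : IsOpen U) :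
    ∃ S : ℕ → Finset (ℝ × ℝ), (∀ k, IsSeparated (S k)) ∧
      (∀ k x, intervalSum (S k) 1 x ≤ U.indicator 1 x) ∧
      ∀ x ∈ U, ∀ᶠ k in Filter.atTop, intervalSum (S k) 1 x = 1 := by
  classical
  have hpos : ∀ k : ℕ, (0 : ℝ) < (k : ℝ) + 1 := fun k => by positivity
  -- Cells of length `1/(k+1)` with indices up to `(k+1)^2` fill `[-(k+1), k+1)`: the mesh shrinks
  -- while the window grows.
  set F : ℕ → Finset ℤ := fun k => (Finset.Ico (-((k + 1) ^ 2 : ℤ)) ((k + 1) ^ 2)).filter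
    fun i => Set.Icc ((i : ℝ) / (k + 1)) ((i + 1) / (k + 1)) ⊆ U with hF
  have hcell : ∀ (k : ℕ) (x : ℝ), x ∈ Set.Icc ((⌊x * (k + 1)⌋ : ℝ) / (k + 1))
      ((⌊x * (k + 1)⌋ + 1) / (k + 1)) := by
    intro k x
    constructor
    · rw [div_le_iff₀ (hpos k)]
      exact Int.floor_le _
    · rw [le_div_iff₀ (hpos k)]
      exact (Int.lt_floor_add_one _).le
  refine ⟨fun k => (F k).image fun i : ℤ => (((i : ℝ) + 1 / 2) / ((k : ℝ) + 1),
    1 / (2 * ((k : ℝ) + 1))), fun k => isSeparated_grid (hpos k) _, fun k x => ?_, fun x hx => ?_⟩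
  · rw [intervalSum_grid (hpos k)]
    split_ifs with h
    · rw [Set.indicator_of_mem ((Finset.mem_filter.1 h).2 (hcell k x))]
      rfl
    · exact zero_le
  · obtain ⟨ε, hε, hball⟩ := Metric.isOpen_iff.1 hU x hx
    obtain ⟨N, hN⟩ := exists_nat_gt (max |x| (1 / ε))
    filter_upwards [Filter.eventually_ge_atTop N] with k hk
    have hkN : (N : ℝ) ≤ k := Nat.cast_le.2 hk
    have hxk : |x| < (k : ℝ) + 1 := by
      have := (le_max_left |x| (1 / ε)).trans_lt hN
      linarith
    have hεk : 1 / ((k : ℝ) + 1) < ε := by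
      have := (le_max_right |x| (1 / ε)).trans_lt hN
      rw [div_lt_comm₀ (hpos k) hε]
      linarith
    rw [intervalSum_grid (hpos k), if_pos]
    obtain ⟨hx1, hx2⟩ := abs_lt.1 hxk
    refine Finset.mem_filter.2 ⟨Finset.mem_Ico.2 ⟨?_, ?_⟩, fun y hy => hball ?_⟩
    · rw [Int.le_floor]
      push_cast
      nlinarith [hpos k]
    · rw [Int.floor_lt]
      push_cast
      nlinarith [hpos k]
    · have h := hcell k x
      have hlen : ((⌊x * (k + 1)⌋ : ℝ) + 1) / (k + 1) = ⌊x * (k + 1)⌋ / (k + 1) + 1 / (k + 1) := by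
        ring
      rw [Metric.mem_ball, Real.dist_eq, abs_lt]
      have h1 := h.1
      have h2 := h.2
      have h3 := hy.1
      have h4 := hy.2
      rw [hlen] at h2 h4
      constructor <;> linarith

theorem ofReal_two_mul_sum_le_volume {S : Finset (ℝ × ℝ)} (hS : IsSeparated S) {U : Set ℝ}
    (hU : MeasurableSet U) (h : ∀ x, intervalSum S 1 x ≤ U.indicator 1 x) :
    ENNReal.ofReal (2 * ∑ p ∈ S, p.2) ≤ volume U := by
  calc ENNReal.ofReal (2 * ∑ p ∈ S, p.2)
      = ∫⁻ x, intervalSum S 1 x := by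
        unfold intervalSum
        rw [lintegral_finsetSum _ fun p _ => measurable_one.indicator measurableSet_Ico,
          Finset.mul_sum, ENNReal.ofReal_sum_of_nonneg fun p hp =>
            mul_nonneg zero_le_two (hS.1 p hp).le]
        refine Finset.sum_congr rfl fun p _ => ?_
        rw [lintegral_indicator_one measurableSet_Ico, Real.volume_Ico]
        congr 1
        ring
    _ ≤ ∫⁻ x, U.indicator 1 x := lintegral_mono h
    _ = volume U := lintegral_indicator_one hU

theorem prod_indicator_one {α β : Type*} {n : ℕ} (A : Fin n → Set β) (l : Fin n → α → β) (z : α) :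
    ∏ j, (A j).indicator (1 : β → ℝ≥0∞) (l j z) = {z | ∀ j, l j z ∈ A j}.indicator 1 z := by
  by_cases h : ∀ j, l j z ∈ A j
  · rw [Set.indicator_of_mem (by exact h)]
    exact Finset.prod_eq_one fun j _ => Set.indicator_of_mem (h j) _
  · rw [Set.indicator_of_notMem (by exact h)]
    push Not at h
    obtain ⟨j, hj⟩ := h
    exact Finset.prod_eq_zero (Finset.mem_univ j) (Set.indicator_of_notMem hj _)

theorem measurableSet_setOf_forall_apply_mem {m n : ℕ} (l : Fin n → (Fin m → ℝ) →ₗ[ℝ] ℝ)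
    {A : Fin n → Set ℝ} (hA : ∀ j, MeasurableSet (A j)) :
    MeasurableSet {z | ∀ j, l j z ∈ A j} := by
  have : {z | ∀ j, l j z ∈ A j} = ⋂ j, l j ⁻¹' A j := by
    ext z
    simp
  rw [this]
  exact MeasurableSet.iInter fun j => (l j).continuous_of_finiteDimensional.measurable (hA j)

theorem measurable_ofReal_two_mul_abs : Measurable fun x : ℝ => ENNReal.ofReal (2 * |x|) := by
  fun_prop

/-- The inequality for open sets, with closed symmetric intervals on the right-hand side. -/
theorem measure_restrict_isOpen_le {m n : ℕ} {C : Set (Fin m → ℝ)} (hC : Convex ℝ C)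
    (hCo : IsOpen C) (hCs : ∀ z ∈ C, -z ∈ C) {l : Fin n → (Fin m → ℝ) →ₗ[ℝ] ℝ}
    (hl : ∀ j, l j ≠ 0) {U : Fin n → Set ℝ} (hU : ∀ j, IsOpen (U j)) :
    volume.restrict C {z | ∀ j, l j z ∈ U j} ≤
      volume.restrict C {z | ∀ j, l j z ∈ {x : ℝ | ENNReal.ofReal (2 * |x|) ≤ volume (U j)}} := by
  choose S hS hSU hlim using fun j => exists_isSeparated_tendsto (hU j)
  have hm1 := measurableSet_setOf_forall_apply_mem l fun j => (hU j).measurableSet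
  have hm2 := measurableSet_setOf_forall_apply_mem l
    (A := fun j => {x : ℝ | ENNReal.ofReal (2 * |x|) ≤ volume (U j)})
    fun j => measurableSet_le measurable_ofReal_two_mul_abs measurable_const
  rw [← lintegral_indicator_one hm1, ← lintegral_indicator_one hm2]
  calc ∫⁻ z in C, {z | ∀ j, l j z ∈ U j}.indicator 1 z
      -- Fatou's lemma suffices, since the bound on each approximant is independent of `k`.
      ≤ ∫⁻ z in C, Filter.liminf (fun k => ∏ j, intervalSum (S j k) 1 (l j z)) Filter.atTop := by
        refine lintegral_mono fun z => ?_
        by_cases hz : ∀ j, l j z ∈ U j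
        · rw [Set.indicator_of_mem (by exact hz)]
          refine Filter.le_liminf_of_le (by isBoundedDefault) ?_
          filter_upwards [Filter.eventually_all.2 fun j => hlim j _ (hz j)] with k hk
          simp [hk]
        · rw [Set.indicator_of_notMem (by exact hz)]
          exact zero_le
    _ ≤ Filter.liminf (fun k => ∫⁻ z in C, ∏ j, intervalSum (S j k) 1 (l j z)) Filter.atTop :=
        lintegral_liminf_le fun k => Finset.measurable_fun_prod _ fun j _ =>
          (measurable_intervalSum _ _).comp (l j).continuous_of_finiteDimensional.measurable
    _ ≤ _ := by
        refine Filter.liminf_le_of_frequently_le' (Filter.Frequently.of_forall fun k => ?_)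
        refine (setLIntegral_prod_intervalSum_le_Ico hC hCo hCs hl (fun j => S j k)
          fun j => hS j k).trans (lintegral_mono fun z => ?_)
        rw [← prod_indicator_one]
        refine Finset.prod_le_prod' fun j _ =>
          Set.indicator_le_indicator_of_subset (fun x hx => ?_) (fun _ => zero_le) _
        refine le_trans (ENNReal.ofReal_le_ofReal ?_)
          (ofReal_two_mul_sum_le_volume (hS j k) (hU j).measurableSet (hSU j k))
        have := abs_le.2 ⟨hx.1, hx.2.le⟩
        linarith

/-- Enlarge `A j` to open sets with excess measure at most `1/(k+1)` and let `k → ∞`. Boundedness of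
`C` provides the finite measure needed for continuity from above. -/
theorem measure_restrict_isOpen_le_of_isBounded {m n : ℕ} {C : Set (Fin m → ℝ)} (hC : Convex ℝ C)
    (hCo : IsOpen C) (hCs : ∀ z ∈ C, -z ∈ C) (hCb : Bornology.IsBounded C)
    {l : Fin n → (Fin m → ℝ) →ₗ[ℝ] ℝ} (hl : ∀ j, l j ≠ 0) {A : Fin n → Set ℝ} :
    volume.restrict C {z | ∀ j, l j z ∈ A j} ≤
      volume.restrict C {z | ∀ j, ENNReal.ofReal (2 * |l j z|) < volume (A j)} := by
  have hfin : IsFiniteMeasure (volume.restrict C) :=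
    isFiniteMeasure_restrict.2 hCb.measure_lt_top.ne
  set B : ℕ → Set (Fin m → ℝ) := fun k => {z | ∀ j, l j z ∈
    {x : ℝ | ENNReal.ofReal (2 * |x|) ≤ volume (A j) + ((k : ℝ≥0∞) + 1)⁻¹}} with hB
  have hBm : ∀ k, MeasurableSet (B k) := fun k => measurableSet_setOf_forall_apply_mem l
    fun j => measurableSet_le measurable_ofReal_two_mul_abs measurable_const
  have hle : ∀ k, volume.restrict C {z | ∀ j, l j z ∈ A j} ≤ volume.restrict C (B k) := by
    intro k
    have hε : ((k : ℝ≥0∞) + 1)⁻¹ ≠ 0 := ENNReal.inv_ne_zero.2 (by finiteness)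
    choose U hAU hUo hUle using fun j => (A j).exists_isOpen_le_add volume hε
    calc volume.restrict C {z | ∀ j, l j z ∈ A j}
        ≤ volume.restrict C {z | ∀ j, l j z ∈ U j} :=
          measure_mono fun z hz j => hAU j (hz j)
      _ ≤ _ := measure_restrict_isOpen_le hC hCo hCs hl hUo
      _ ≤ _ := by
        refine measure_mono fun z hz j => ?_
        have h : ENNReal.ofReal (2 * |l j z|) ≤ volume (U j) := hz j
        exact h.trans (hUle j)
  have hanti : Antitone B := by
    intro i k hik z hz j
    have h : ENNReal.ofReal (2 * |l j z|) ≤ volume (A j) + ((k : ℝ≥0∞) + 1)⁻¹ := hz j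
    refine h.trans ?_
    gcongr
  have hlim := tendsto_measure_iInter_atTop (fun k => (hBm k).nullMeasurableSet) hanti
    ⟨0, measure_ne_top (volume.restrict C) _⟩
  refine (ge_of_tendsto' hlim hle).trans (measure_mono_ae (ae_restrict_of_ae ?_))
  -- The limit gives `≤`; equality forces `volume (A j)` finite and `l j z` to be plus or minus half
  -- of it, a null event.
  filter_upwards [ae_all_iff.2 fun j => ae_apply_ne (hl j) ((volume (A j)).toReal / 2),
    ae_all_iff.2 fun j => ae_apply_ne (hl j) (-((volume (A j)).toReal / 2))] with z hz1 hz2 hz j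
  have hzB : ∀ k : ℕ, ENNReal.ofReal (2 * |l j z|) ≤ volume (A j) + ((k : ℝ≥0∞) + 1)⁻¹ :=
    fun k => (Set.mem_iInter.1 hz k) j
  have htend : Filter.Tendsto (fun k : ℕ => volume (A j) + ((k : ℝ≥0∞) + 1)⁻¹) Filter.atTop
      (nhds (volume (A j) + 0)) := by
    refine tendsto_const_nhds.add ?_
    have := (Filter.tendsto_add_atTop_iff_nat 1).2 ENNReal.tendsto_inv_nat_nhds_zero
    simpa using this
  rw [add_zero] at htend
  refine lt_of_le_of_ne (ge_of_tendsto' htend hzB) fun heq => ?_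
  have h2 : 2 * |l j z| = (volume (A j)).toReal := by
    rw [← heq, ENNReal.toReal_ofReal (by positivity)]
  rcases abs_cases (l j z) with ⟨h, -⟩ | ⟨h, -⟩
  · exact hz1 j (by linarith)
  · exact hz2 j (by linarith)

/-- The inequality for sets. -/
theorem measure_restrict_convex_le {m n : ℕ} {C : Set (Fin m → ℝ)} (hC : IsBalancedConvex C)
    {l : Fin n → (Fin m → ℝ) →ₗ[ℝ] ℝ} (hl : ∀ j, l j ≠ 0) {A : Fin n → Set ℝ}
    (hA : ∀ j, MeasurableSet (A j)) :
    volume.restrict C {z | ∀ j, l j z ∈ A j} ≤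
      volume.restrict C {z | ∀ j, ENNReal.ofReal (2 * |l j z|) < volume (A j)} := by
  have hneg : ∀ z ∈ interior C, -z ∈ interior C := by
    intro z hz
    refine interior_maximal (t := -interior C) (s := C) (fun y hy => ?_)
      isOpen_interior.neg (by simpa using hz)
    exact (hC.2 y).2 (interior_subset hy)
  -- The frontier of a convex set is null, so `C` may be replaced by its interior.
  have hres : volume.restrict C = volume.restrict (interior C) :=
    (Measure.restrict_congr_set
      (interior_ae_eq_of_null_frontier (hC.1.addHaar_frontier volume))).symm
  set D : ℕ → Set (Fin m → ℝ) := fun k => interior C ∩ Metric.ball 0 k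
  have hD : interior C = ⋃ k, D k := by
    rw [← Set.inter_iUnion, Metric.iUnion_ball_nat, Set.inter_univ]
  have hDmono : Monotone D := fun i k hik =>
    Set.inter_subset_inter_right _ (Metric.ball_subset_ball (Nat.cast_le.2 hik))
  rw [hres, hD, Measure.restrict_iUnion_apply_eq_iSup hDmono.directed_le
    (measurableSet_setOf_forall_apply_mem l hA)]
  refine iSup_le fun k => ?_
  refine (measure_restrict_isOpen_le_of_isBounded (hC.1.interior.inter (convex_ball 0 _))
    (isOpen_interior.inter Metric.isOpen_ball) ?_
    (Metric.isBounded_ball.subset Set.inter_subset_right) hl).trans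
    (Measure.restrict_mono (Set.subset_iUnion D k) le_rfl _)
  rintro z ⟨hz, hzk⟩
  exact ⟨hneg z hz, by simpa using hzk⟩

/-! ### Superlevel sets of rearrangements -/

theorem distributionFunction_antitone {α : Type*} [MeasurableSpace α] (μ : Measure α)
    (f : α → ℝ≥0∞) : Antitone (distributionFunction μ f) :=
  fun _ _ h => measure_mono fun _ hx => lt_of_le_of_lt h hx

/-- Right continuity of the distribution function, from continuity of measure along increasing
unions; it makes the infimum defining the rearrangement attained. -/
theorem distributionFunction_eq_iSup {α : Type*} [MeasurableSpace α] (μ : Measure α)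
    (f : α → ℝ≥0∞) {s : ℝ≥0∞} (hs : s ≠ ∞) :
    ∃ u : ℕ → ℝ≥0∞, (∀ k, s < u k) ∧
      distributionFunction μ f s = ⨆ k, distributionFunction μ f (u k) := by
  obtain ⟨u, hu, hsu, hlim⟩ := exists_seq_strictAnti_tendsto' (lt_top_iff_ne_top.2 hs)
  refine ⟨u, fun k => (hsu k).1, ?_⟩
  have hU : {x | s < f x} = ⋃ k, {x | u k < f x} := by
    ext x
    simp only [Set.mem_ofPred_eq, Set.mem_iUnion]
    exact ⟨fun h => (hlim.eventually (gt_mem_nhds h)).exists, fun ⟨k, h⟩ => (hsu k).1.trans h⟩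
  have hmono : Monotone fun k => {x | u k < f x} :=
    fun i k hik x hx => lt_of_le_of_lt (hu.antitone hik) hx
  rw [distributionFunction, hU, hmono.measure_iUnion]
  rfl

/-- The superlevel sets of the decreasing rearrangement. -/
theorem lt_decreasingRearrangement_iff {α : Type*} [MeasurableSpace α] (μ : Measure α)
    (f : α → ℝ≥0∞) (s t : ℝ≥0∞) :
    s < decreasingRearrangement μ f t ↔ t < distributionFunction μ f s := by
  rw [← not_iff_not, not_lt, not_lt]
  constructor
  · intro h
    rcases eq_or_ne s ∞ with rfl | hs
    · simp [distributionFunction]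
    obtain ⟨u, hu, heq⟩ := distributionFunction_eq_iSup μ f hs
    rw [heq]
    refine iSup_le fun k => ?_
    obtain ⟨v, hv, hvk⟩ := sInf_lt_iff.1 (lt_of_le_of_lt h (hu k))
    exact (distributionFunction_antitone μ f hvk.le).trans hv
  · exact fun h => sInf_le h

theorem lt_symmetricRearrangement_iff (f : ℝ → ℝ≥0∞) (s : ℝ≥0∞) (x : ℝ) :
    s < symmetricRearrangement f x ↔ ENNReal.ofReal (2 * |x|) < volume {y | s < f y} :=
  lt_decreasingRearrangement_iff _ _ _ _

theorem symmetricRearrangement_congr_ae {f g : ℝ → ℝ≥0∞} (h : f =ᵐ[volume] g) :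
    symmetricRearrangement f = symmetricRearrangement g := by
  funext x
  refine eq_of_forall_lt_iff fun s => ?_
  rw [lt_symmetricRearrangement_iff, lt_symmetricRearrangement_iff]
  have : volume {y | s < f y} = volume {y | s < g y} := by
    refine measure_congr ?_
    filter_upwards [h] with y hy
    exact congrArg (s < ·) hy
  rw [this]

theorem measurable_symmetricRearrangement (f : ℝ → ℝ≥0∞) :
    Measurable (symmetricRearrangement f) := by
  refine measurable_of_Ioi fun s => ?_
  have : symmetricRearrangement f ⁻¹' Set.Ioi s =
      {x | ENNReal.ofReal (2 * |x|) < volume {y | s < f y}} := by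
    ext x
    exact lt_symmetricRearrangement_iff f s x
  rw [this]
  exact measurableSet_lt measurable_ofReal_two_mul_abs measurable_const

theorem lt_indicator_one_iff {α : Type*} (A : Set α) (s : ℝ≥0∞) (x : α) :
    s < A.indicator 1 x ↔ s < 1 ∧ x ∈ A := by
  by_cases hx : x ∈ A <;> simp [hx]

/-- Rearrangement commutes with passing to superlevel sets. -/
theorem symmetricRearrangement_indicator (A : Set ℝ) :
    symmetricRearrangement (A.indicator 1) =
      {x | ENNReal.ofReal (2 * |x|) < volume A}.indicator 1 := by
  funext x
  refine eq_of_forall_lt_iff fun s => ?_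
  rw [lt_symmetricRearrangement_iff, lt_indicator_one_iff]
  simp_rw [lt_indicator_one_iff]
  by_cases hs : s < 1
  · simp [hs]
  · simp [hs]

theorem symmetricRearrangement_indicator_superlevel (f : ℝ → ℝ≥0∞) (s : ℝ≥0∞) :
    symmetricRearrangement ({y | s < f y}.indicator 1) =
      {x | s < symmetricRearrangement f x}.indicator 1 := by
  rw [symmetricRearrangement_indicator]
  congr 1
  ext x
  exact (lt_symmetricRearrangement_iff f s x).symm

/-! ### From sets to functions -/

theorem IsSteinerConvex.aemeasurable {m : ℕ} {K : (Fin m → ℝ) → ℝ≥0∞} (hK : IsSteinerConvex K) :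
    AEMeasurable K volume := by
  refine NullMeasurable.aemeasurable ?_
  have : @Measurable (NullMeasurableSpace (Fin m → ℝ) volume) _ _ _ K :=
    measurable_of_Ioi fun s => (hK s).1.nullMeasurableSet volume
  exact fun s hs => this hs

theorem measurable_prod_comp_linearMap {m n : ℕ} {f : Fin n → ℝ → ℝ≥0∞}
    (hf : ∀ j, Measurable (f j)) (l : Fin n → (Fin m → ℝ) →ₗ[ℝ] ℝ) (T : Finset (Fin n)) :
    Measurable fun z => ∏ j ∈ T, f j (l j z) :=
  Finset.measurable_fun_prod _ fun j _ =>
    (hf j).comp (l j).continuous_of_finiteDimensional.measurable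

/-- The inequality for indicator functions. -/
theorem lintegral_prod_indicator_mul_le {m n : ℕ} {K K' : (Fin m → ℝ) → ℝ≥0∞}
    (hK : IsSteinerConvex K) (hK' : Measurable K') (hKK' : K =ᵐ[volume] K')
    {l : Fin n → (Fin m → ℝ) →ₗ[ℝ] ℝ} (hl : ∀ j, l j ≠ 0) {A : Fin n → Set ℝ}
    (hA : ∀ j, MeasurableSet (A j)) :
    ∫⁻ z, (∏ j, (A j).indicator 1 (l j z)) * K' z ≤
      ∫⁻ z, (∏ j, symmetricRearrangement ((A j).indicator 1) (l j z)) * K' z := by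
  have hlevel : ∀ B : Fin n → Set ℝ, (∀ j, MeasurableSet (B j)) →
      ∫⁻ z, (∏ j, (B j).indicator 1 (l j z)) * K' z = ∫⁻ s in Set.Ioi (0 : ℝ),
        volume.restrict {z | ENNReal.ofReal s < K z} {z | ∀ j, l j z ∈ B j} := by
    intro B hB
    have hBm := measurableSet_setOf_forall_apply_mem l hB
    simp_rw [fun z => prod_indicator_one B (fun j => l j) z, mul_comm _ (K' _)]
    rw [lintegral_mul_eq_lintegral_superlevel volume hK' (measurable_one.indicator hBm)]
    refine lintegral_congr fun s => ?_
    -- Superlevel sets of the measurable version `K'` need not be convex, but agree almost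
    -- everywhere with those of `K`.
    have hset : {z | ENNReal.ofReal s < K z} =ᵐ[volume] {z | ENNReal.ofReal s < K' z} := by
      filter_upwards [hKK'] with y hy
      exact congrArg (ENNReal.ofReal s < ·) hy
    rw [Measure.restrict_congr_set hset, ← lintegral_indicator_one hBm,
      ← lintegral_indicator (measurableSet_lt measurable_const hK')]
    refine lintegral_congr fun z => ?_
    by_cases hz : ENNReal.ofReal s < K' z <;> simp [Set.indicator, hz]
  simp_rw [symmetricRearrangement_indicator]
  rw [hlevel A hA, hlevel _ fun j => measurableSet_lt measurable_ofReal_two_mul_abs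
    measurable_const]
  exact lintegral_mono fun s => measure_restrict_convex_le (hK _) hl hA

/-- If the inequality holds for indicator functions, then it holds for all measurable functions. -/
theorem lintegral_prod_mul_le_of_indicator {m n : ℕ} {K : (Fin m → ℝ) → ℝ≥0∞} (hK : Measurable K)
    {l : Fin n → (Fin m → ℝ) →ₗ[ℝ] ℝ}
    (H : ∀ A : Fin n → Set ℝ, (∀ j, MeasurableSet (A j)) →
      ∫⁻ z, (∏ j, (A j).indicator 1 (l j z)) * K z ≤
        ∫⁻ z, (∏ j, symmetricRearrangement ((A j).indicator 1) (l j z)) * K z)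
    (T : Finset (Fin n)) (f : Fin n → ℝ → ℝ≥0∞) (hf : ∀ j, Measurable (f j))
    (hT : ∀ j ∉ T, ∃ A, MeasurableSet A ∧ f j = A.indicator 1) :
    ∫⁻ z, (∏ j, f j (l j z)) * K z ≤
      ∫⁻ z, (∏ j, symmetricRearrangement (f j) (l j z)) * K z := by
  -- `T` contains every index whose function may fail to be an indicator. Slicing `f i` by layer
  -- cake replaces it by indicators, and rearrangement commutes with the slicing.
  induction T using Finset.induction_on generalizing f with
  | empty =>
    choose A hA hfA using fun j => hT j (Finset.notMem_empty j)
    obtain rfl : f = fun j => (A j).indicator 1 := funext hfA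
    exact H A hA
  | insert i T hi ih =>
    have hsplit : ∀ g : Fin n → ℝ → ℝ≥0∞, (∀ j, Measurable (g j)) →
        ∫⁻ z, (∏ j, g j (l j z)) * K z = ∫⁻ s in Set.Ioi (0 : ℝ),
          ∫⁻ z, {y | ENNReal.ofReal s < g i y}.indicator 1 (l i z) *
            ((∏ j ∈ Finset.univ.erase i, g j (l j z)) * K z) := by
      intro g hg
      simp_rw [← Finset.mul_prod_erase Finset.univ _ (Finset.mem_univ i), mul_assoc]
      exact lintegral_mul_eq_lintegral_superlevel volume
        ((hg i).comp (l i).continuous_of_finiteDimensional.measurable)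
        ((measurable_prod_comp_linearMap hg l _).mul hK)
    rw [hsplit f hf, hsplit _ fun j => measurable_symmetricRearrangement (f j)]
    refine lintegral_mono fun s => ?_
    set A := {y | ENNReal.ofReal s < f i y} with hAdef
    have hA : MeasurableSet A := measurableSet_lt measurable_const (hf i)
    have key := ih (Function.update f i (A.indicator 1)) (fun j => ?_) (fun j hj => ?_)
    · simp_rw [← Finset.mul_prod_erase Finset.univ _ (Finset.mem_univ i), mul_assoc] at key
      simp only [Function.update_self] at key
      rw [symmetricRearrangement_indicator_superlevel] at key
      have hrest : ∀ (Φ : (ℝ → ℝ≥0∞) → ℝ → ℝ≥0∞) (z : Fin m → ℝ),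
          ∏ j ∈ Finset.univ.erase i, Φ (Function.update f i (A.indicator 1) j) (l j z) =
            ∏ j ∈ Finset.univ.erase i, Φ (f j) (l j z) := fun Φ z =>
        Finset.prod_congr rfl fun j hj => by
          rw [Function.update_of_ne (Finset.ne_of_mem_erase hj)]
      simp_rw [hrest symmetricRearrangement, hrest (fun g => g)] at key
      exact key
    · rcases eq_or_ne j i with rfl | hji
      · simpa using measurable_one.indicator hA
      · simpa [hji] using hf j
    · rcases eq_or_ne j i with rfl | hji
      · exact ⟨A, hA, by simp⟩
      · simpa [hji] using hT j (by simp [hji, hj])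

theorem theorem5p7 (m n : ℕ) (f : Fin n → ℝ → ℝ≥0∞) (hf : ∀ j, AEMeasurable (f j) volume)
    (K : (Fin m → ℝ) → ℝ≥0∞) (hK : IsSteinerConvex K)
    (l : Fin n → (Fin m → ℝ) →ₗ[ℝ] ℝ) (hl : ∀ j, l j ≠ 0) :
    ∫⁻ z : Fin m → ℝ, (∏ j, f j (l j z)) * K z ≤
      ∫⁻ z : Fin m → ℝ, (∏ j, symmetricRearrangement (f j) (l j z)) * K z := by
  have hKm := hK.aemeasurable
  have hfl : ∀ᵐ z : Fin m → ℝ, ∀ j, f j (l j z) = (hf j).mk (f j) (l j z) :=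
    ae_all_iff.2 fun j => (quasiMeasurePreserving_of_ne_zero (hl j)).ae_eq_comp (hf j).ae_eq_mk
  have key := lintegral_prod_mul_le_of_indicator hKm.measurable_mk
    (fun A hA => lintegral_prod_indicator_mul_le hK hKm.measurable_mk hKm.ae_eq_mk hl hA)
    Finset.univ (fun j => (hf j).mk (f j)) (fun j => (hf j).measurable_mk) (by simp)
  simp_rw [← fun j => symmetricRearrangement_congr_ae (hf j).ae_eq_mk] at key
  refine le_of_eq_of_le (lintegral_congr_ae ?_) (key.trans_eq (lintegral_congr_ae ?_))
  · filter_upwards [hfl, hKm.ae_eq_mk] with z hz hzK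
    simp_rw [hz, hzK]
  · filter_upwards [hKm.ae_eq_mk] with z hzK
    rw [hzK]
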